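/- Let $M$ be a smooth manifold of dimension $4n$ with a hypercomplex structure $H=(J_1,J_2,J_3)$, i.e. a triple of integrable almost complex structures with $J_1J_2=-J_2J_1=J_3$, and a Riemannian metric $g$ with $g(J_s\cdot,J_s\cdot)=g(\cdot,\cdot)$ for $s=1,2,3$. Suppose that $(M,H,g)$ is an HKT manifold with HKT connection $\nabla$; that is, $\nabla$ is a linear connection with $\nabla g=0$ and $\nabla J_1=\nabla J_2=\nabla J_3=0$ whose torsion $T(X,Y)=\nabla_XY-\nabla_YX-[X,Y]$ is totally skew-symmetric, meaning that $T(X,Y,Z)=g(T(X,Y),Z)$ is a $3$-form. Then the Obata connection $\nabla^{ob}$ of $(M,H)$, i.e. the torsion-free linear connection with $\nabla^{ob}J_1=\nabla^{ob}J_2=\nabla^{ob}J_3=0$, exists, and it is related to $\nabla$ by $$g(\nabla^{ob}_XY,Z)=g(\nabla_XY,Z)+A(X,Y,Z)$$ for all vector fields $X,Y,Z$, where $$2A(X,Y,Z)=-T(X,J_1Y,J_1Z)-T(J_1X,J_1Y,Z)-T(X,J_3Y,J_3Z)-T(J_1X,J_3Y,J_2Z).$$ (The formula holds for every connection with the defining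 properties of $\nabla^{ob}$, so that it is unique.) -/

import Mathlib

open Bundle VectorField
open scoped Manifold ContDiff

noncomputable section

variable {E : Type*} [NormedAddCommGroup E] [NormedSpace ℝ E]
  {H : Type*} [TopologicalSpace H] {I : ModelWithCorners ℝ E H}
  {M : Type*} [TopologicalSpace M] [ChartedSpace H M]

/-- A smooth almost complex structure on `M`: a smooth field of endomorphisms `J` of the tangent
spaces with `J² = -id`. -/
structure AlmostComplexStructure (I : ModelWithCorners ℝ E H) (M : Type*) [TopologicalSpace M]
    [ChartedSpace H M] [IsManifold I 1 M] where
  /-- The endomorphism of each tangent space. -/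
  toFun : ∀ x : M, TangentSpace I x →L[ℝ] TangentSpace I x
  smooth : ContMDiff I (I.prod 𝓘(ℝ, E →L[ℝ] E)) ∞
    (fun x : M ↦ (TotalSpace.mk' (E →L[ℝ] E) x (toFun x) :
      TotalSpace (E →L[ℝ] E) (fun x : M ↦ TangentSpace I x →L[ℝ] TangentSpace I x)))
  sq : ∀ (x : M) (v : TangentSpace I x), toFun x (toFun x v) = -v

namespace AlmostComplexStructure

variable [IsManifold I 1 M]

instance : CoeFun (AlmostComplexStructure I M)
    fun _ ↦ ∀ x : M, TangentSpace I x →L[ℝ] TangentSpace I x := ⟨toFun⟩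

/-- The vector field `J X`. -/
def app (J : AlmostComplexStructure I M) (X : ∀ x : M, TangentSpace I x) :
    ∀ x : M, TangentSpace I x := fun x ↦ J x (X x)

/-- The Nijenhuis tensor `N_J(X, Y) = [JX, JY] - J[JX, Y] - J[X, JY] - [X, Y]`. -/
def nijenhuis (J : AlmostComplexStructure I M) (X Y : ∀ x : M, TangentSpace I x) (x : M) :
    TangentSpace I x :=
  mlieBracket I (J.app X) (J.app Y) x - J x (mlieBracket I (J.app X) Y x)
    - J x (mlieBracket I X (J.app Y) x) - mlieBracket I X Y x

/-- `J` is integrable (a complex structure): its Nijenhuis tensor vanishes. -/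
def IsIntegrable (J : AlmostComplexStructure I M) : Prop :=
  ∀ (X Y : ∀ x : M, TangentSpace I x) (x : M),
    MDiffAt (T% X) x → MDiffAt (T% Y) x → J.nijenhuis X Y x = 0

end AlmostComplexStructure

/-- A hypercomplex structure `(J₁, J₂, J₃)`: three integrable almost complex structures satisfying
`J₁ J₂ = -J₂ J₁ = J₃`. -/
structure HypercomplexStructure (I : ModelWithCorners ℝ E H) (M : Type*) [TopologicalSpace M]
    [ChartedSpace H M] [IsManifold I 1 M] where
  /-- The first complex structure. -/
  J₁ : AlmostComplexStructure I M
  /-- The second complex structure. -/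
  J₂ : AlmostComplexStructure I M
  /-- The third complex structure. -/
  J₃ : AlmostComplexStructure I M
  mul₁₂ : ∀ (x : M) (v : TangentSpace I x), J₁ x (J₂ x v) = J₃ x v
  mul₂₁ : ∀ (x : M) (v : TangentSpace I x), J₂ x (J₁ x v) = -J₃ x v
  integrable₁ : J₁.IsIntegrable
  integrable₂ : J₂.IsIntegrable
  integrable₃ : J₃.IsIntegrable

/-- A linear connection on `M`, written `∇ Y x v = (∇_v Y)(x)`, preserves `J`: the covariant
derivative `(∇_X J) Y = ∇_X (J Y) - J (∇_X Y)` vanishes. -/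
def Preserves [IsManifold I 1 M]
    (cov : CovariantDerivative I E (TangentSpace I : M → Type _))
    (J : AlmostComplexStructure I M) : Prop :=
  ∀ (Y : ∀ x : M, TangentSpace I x) (x : M) (v : TangentSpace I x),
    MDiffAt (T% Y) x → cov (J.app Y) x v = J x (cov Y x v)

/-- A smooth linear connection preserving all three complex structures. -/
structure IsHypercomplexConnection [IsManifold I 1 M] (S : HypercomplexStructure I M)
    (cov : CovariantDerivative I E (TangentSpace I : M → Type _)) : Prop where
  smooth : cov.ContMDiffCovariantDerivative ∞
  preserves₁ : Preserves cov S.J₁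
  preserves₂ : Preserves cov S.J₂
  preserves₃ : Preserves cov S.J₃

/-- An Obata connection of a hypercomplex structure: a torsion-free linear connection preserving
the three complex structures. -/
structure IsObataConnection [FiniteDimensional ℝ E] [IsManifold I 2 M] [IsManifold I 1 M]
    (S : HypercomplexStructure I M)
    (cov : CovariantDerivative I E (TangentSpace I : M → Type _)) : Prop
    extends IsHypercomplexConnection S cov where
  torsion_eq_zero : cov.torsion = 0

section Metric

variable [IsManifold I 1 M]

/-- The Riemannian metric `g` is Hermitian with respect to `J`: `g(J·, J·) = g(·, ·)`. -/
def IsHermitian (g : ContMDiffRiemannianMetric I ∞ E (TangentSpace I : M → Type _))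
    (J : AlmostComplexStructure I M) : Prop :=
  ∀ (x : M) (u v : TangentSpace I x), g.inner x (J x u) (J x v) = g.inner x u v

/-- The Riemannian metric `g` is hyperhermitian: it is Hermitian with respect to all three complex
structures. -/
structure IsHyperhermitian (g : ContMDiffRiemannianMetric I ∞ E (TangentSpace I : M → Type _))
    (S : HypercomplexStructure I M) : Prop where
  hermitian₁ : IsHermitian g S.J₁
  hermitian₂ : IsHermitian g S.J₂
  hermitian₃ : IsHermitian g S.J₃

/-- The connection preserves the metric: `v(g(Y, Z)) = g(∇_v Y, Z) + g(Y, ∇_v Z)`. -/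
def PreservesMetric (g : ContMDiffRiemannianMetric I ∞ E (TangentSpace I : M → Type _))
    (cov : CovariantDerivative I E (TangentSpace I : M → Type _)) : Prop :=
  ∀ (Y Z : ∀ x : M, TangentSpace I x) (x : M) (v : TangentSpace I x),
    MDiffAt (T% Y) x → MDiffAt (T% Z) x →
      mvfderiv I (fun y : M ↦ g.inner y (Y y) (Z y)) x v =
        g.inner x (cov Y x v) (Z x) + g.inner x (Y x) (cov Z x v)

variable [FiniteDimensional ℝ E] [IsManifold I 2 M]

/-- The torsion as a covariant 3-tensor, `T(u, v, w) = g(T(u, v), w)`, where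
`T(X, Y) = ∇_X Y - ∇_Y X - [X, Y]`. -/
def torsion₃ (g : ContMDiffRiemannianMetric I ∞ E (TangentSpace I : M → Type _))
    (cov : CovariantDerivative I E (TangentSpace I : M → Type _)) (x : M)
    (u v w : TangentSpace I x) : ℝ :=
  g.inner x (cov.torsion x u v) w

/-- An HKT connection: a linear connection preserving the hyperhermitian structure (the metric and
the three complex structures) whose torsion is totally skew-symmetric. -/
structure IsHKTConnection (g : ContMDiffRiemannianMetric I ∞ E (TangentSpace I : M → Type _))
    (S : HypercomplexStructure I M)
    (cov : CovariantDerivative I E (TangentSpace I : M → Type _)) : Prop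
    extends IsHypercomplexConnection S cov where
  metric : PreservesMetric g cov
  skew₁₂ : ∀ (x : M) (u v w : TangentSpace I x),
    torsion₃ g cov x u v w = -torsion₃ g cov x v u w
  skew₂₃ : ∀ (x : M) (u v w : TangentSpace I x),
    torsion₃ g cov x u v w = -torsion₃ g cov x u w v

/-- The tensor `A`, defined by
`2 A(X,Y,Z) = -T(X,J₁Y,J₁Z) - T(J₁X,J₁Y,Z) - T(X,J₃Y,J₃Z) - T(J₁X,J₃Y,J₂Z)`. -/
def differenceTensor (g : ContMDiffRiemannianMetric I ∞ E (TangentSpace I : M → Type _))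
    (S : HypercomplexStructure I M)
    (cov : CovariantDerivative I E (TangentSpace I : M → Type _)) (x : M)
    (X Y Z : TangentSpace I x) : ℝ :=
  (1 / 2 : ℝ) *
    (-torsion₃ g cov x X (S.J₁ x Y) (S.J₁ x Z)
      - torsion₃ g cov x (S.J₁ x X) (S.J₁ x Y) Z
      - torsion₃ g cov x X (S.J₃ x Y) (S.J₃ x Z)
      - torsion₃ g cov x (S.J₁ x X) (S.J₃ x Y) (S.J₂ x Z))

end Metric

end

/-! Write the Obata connection as `∇ + B`. It preserves each `J` when `B` is `J`-linear in the
differentiated slot `v`, and it is torsion-free when antisymmetrizing `B` cancels `T`. Integrability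
gives the needed input: `T` has no `(0,2)` part for any `Jₛ` (`torsion_eq_of_preserves`). For a
direction `u`, put `P v = T(J₁v, J₁u) - J₁T(J₁v, u)`. The type condition for `J₁` makes `P`
`J₁`-linear. `B = ½(P - J₂PJ₂)` is its `J₂`-linear part, still `J₁`-linear because `J₁` anticommutes
with both factors `J₂`. The three type conditions together give the antisymmetrization
(`obataTensor_sub_swap`). Two Obata connections differ by a symmetric tensor linear over `J₁` and
`J₂`, and such a tensor is zero. Pairing `B` with `g`, for which each `Jₛ` is skew, gives `A`. -/

noncomputable section

open scoped Topology

variable {E : Type*} [NormedAddCommGroup E] [NormedSpace ℝ E]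
  {H : Type*} [TopologicalSpace H] {I : ModelWithCorners ℝ E H}
  {M : Type*} [TopologicalSpace M] [ChartedSpace H M]

/-! ### Smoothness of sections of Hom bundles -/

section HomSections

/-- A section that is smooth on an open set agrees near each point of that set with a globally
smooth section. -/
lemma exists_contMDiff_section_eventuallyEq [FiniteDimensional ℝ E] [T2Space M] [IsManifold I ∞ M]
    {F : Type*} [NormedAddCommGroup F] [NormedSpace ℝ F]
    {V : M → Type*} [TopologicalSpace (TotalSpace F V)] [∀ x, AddCommGroup (V x)]
    [∀ x, Module ℝ (V x)] [∀ x, TopologicalSpace (V x)] [FiberBundle F V] [VectorBundle ℝ F V]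
    {s : ∀ x : M, V x} {u : Set M} (hu : IsOpen u)
    (hs : ContMDiffOn I (I.prod 𝓘(ℝ, F)) ∞ (fun x ↦ (TotalSpace.mk' F x (s x))) u)
    {x : M} (hx : x ∈ u) :
    ∃ t : ∀ x : M, V x, ContMDiff I (I.prod 𝓘(ℝ, F)) ∞ (fun x ↦ (TotalSpace.mk' F x (t x))) ∧
      ∀ᶠ y in 𝓝 x, t y = s y := by
  obtain ⟨f, -, hf⟩ := (SmoothBumpFunction.nhds_basis_tsupport (I := I) x).mem_iff.1
    (hu.mem_nhds hx)
  refine ⟨(f : M → ℝ) • s, ContMDiffOn.smul_section_of_tsupport f.contMDiff.contMDiffOn hu hf hs,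
    ?_⟩
  filter_upwards [f.eventuallyEq_one] with y hy
  simp [hy]

/-- A map into a space of continuous linear maps with finite-dimensional source is `C^k` if its
evaluations at the vectors of a basis are. -/
lemma contMDiffAt_clm_of_basis {F F' ι : Type*} [NormedAddCommGroup F] [NormedSpace ℝ F]
    [NormedAddCommGroup F'] [NormedSpace ℝ F'] [FiniteDimensional ℝ F] [Fintype ι]
    (b : Module.Basis ι ℝ F) {k : WithTop ℕ∞} {f : M → F →L[ℝ] F'} {x : M}
    (h : ∀ i, ContMDiffAt I 𝓘(ℝ, F') k (fun y ↦ f y (b i)) x) :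
    ContMDiffAt I 𝓘(ℝ, F →L[ℝ] F') k f x := by
  have key : f = fun y ↦ ∑ i, ContinuousLinearMap.smulRightL ℝ F F'
      (LinearMap.toContinuousLinearMap (b.coord i)) (f y (b i)) := by
    ext y v
    conv_lhs => rw [← b.sum_repr v, map_sum]
    simp
  rw [key]
  refine ContMDiffAt.sum fun i _ ↦ ?_
  exact (ContinuousLinearMap.contDiff _).contMDiff.contMDiffAt.comp x (h i)

variable {F₁ F₂ : Type*} [NormedAddCommGroup F₁] [NormedSpace ℝ F₁] [NormedAddCommGroup F₂]
  [NormedSpace ℝ F₂] {V₁ V₂ : M → Type*}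
  [TopologicalSpace (TotalSpace F₁ V₁)] [∀ x, AddCommGroup (V₁ x)] [∀ x, Module ℝ (V₁ x)]
  [∀ x, TopologicalSpace (V₁ x)] [FiberBundle F₁ V₁] [VectorBundle ℝ F₁ V₁]
  [TopologicalSpace (TotalSpace F₂ V₂)] [∀ x, AddCommGroup (V₂ x)] [∀ x, Module ℝ (V₂ x)]
  [∀ x, TopologicalSpace (V₂ x)] [FiberBundle F₂ V₂] [VectorBundle ℝ F₂ V₂]
  [∀ x, IsTopologicalAddGroup (V₂ x)] [∀ x, ContinuousSMul ℝ (V₂ x)]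

/-- A section of a Hom bundle is smooth if it maps smooth sections to smooth sections. -/
lemma contMDiff_hom_section_of_forall_apply [FiniteDimensional ℝ E] [T2Space M] [IsManifold I ∞ M]
    [FiniteDimensional ℝ F₁] [ContMDiffVectorBundle ∞ F₁ V₁ I] [ContMDiffVectorBundle ∞ F₂ V₂ I]
    {Φ : ∀ x : M, V₁ x →L[ℝ] V₂ x}
    (h : ∀ s : ∀ x : M, V₁ x, ContMDiff I (I.prod 𝓘(ℝ, F₁)) ∞ (fun x ↦ TotalSpace.mk' F₁ x (s x)) →
      ContMDiff I (I.prod 𝓘(ℝ, F₂)) ∞ (fun x ↦ TotalSpace.mk' F₂ x (Φ x (s x)))) :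
    ContMDiff I (I.prod 𝓘(ℝ, F₁ →L[ℝ] F₂)) ∞
      (fun x ↦ (TotalSpace.mk' (F₁ →L[ℝ] F₂) x (Φ x) :
        TotalSpace (F₁ →L[ℝ] F₂) (fun x : M ↦ V₁ x →L[ℝ] V₂ x))) := by
  intro x₀
  rw [contMDiffAt_hom_bundle]
  refine ⟨contMDiffAt_id, contMDiffAt_clm_of_basis (Module.finBasis ℝ F₁) fun i ↦ ?_⟩
  set e₁ := trivializationAt F₁ V₁ x₀
  set e₂ := trivializationAt F₂ V₂ x₀
  have hx₁ : x₀ ∈ e₁.baseSet := mem_baseSet_trivializationAt F₁ V₁ x₀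
  have hx₂ : x₀ ∈ e₂.baseSet := mem_baseSet_trivializationAt F₂ V₂ x₀
  -- The hypothesis only sees global sections, so the local frame is cut off by a bump function.
  obtain ⟨t, ht, hteq⟩ := exists_contMDiff_section_eventuallyEq e₁.open_baseSet
    (e₁.contMDiffOn_localFrame_baseSet (I := I) ∞ (Module.finBasis ℝ F₁) i) hx₁
  have := (contMDiffAt_totalSpace.1 (h t ht x₀)).2
  refine this.congr_of_eventuallyEq ?_
  filter_upwards [hteq, e₁.open_baseSet.mem_nhds hx₁, e₂.open_baseSet.mem_nhds hx₂]
    with y hy hy₁ hy₂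
  rw [ContinuousLinearMap.inCoordinates_eq hy₁ hy₂]
  simp [hy, hy₁, e₁, e₂, Trivialization.basisAt]

end HomSections

/-! ### Pointwise quaternionic algebra -/

section QuaternionicAlgebra

variable {V : Type*} [AddCommGroup V] [Module ℝ V] [TopologicalSpace V]

/-- A symmetric bilinear map that is linear in one argument over two anticommuting complex
structures vanishes. -/
lemma eq_zero_of_symm_of_commute {J₁ J₂ J₃ : V →L[ℝ] V} {B : V → V → V}
    (symm : ∀ u v, B u v = B v u)
    (sq₁ : ∀ v, J₁ (J₁ v) = -v) (sq₂ : ∀ v, J₂ (J₂ v) = -v)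
    (mul₁₂ : ∀ v, J₁ (J₂ v) = J₃ v) (mul₂₁ : ∀ v, J₂ (J₁ v) = -J₃ v)
    (h₁ : ∀ u v, B u (J₁ v) = J₁ (B u v)) (h₂ : ∀ u v, B u (J₂ v) = J₂ (B u v)) (u v : V) :
    B u v = 0 := by
  -- By symmetry `J₁` and `J₂` can act in different slots, where their order is irrelevant; yet they
  -- anticommute.
  have h : J₁ (J₂ (B u v)) = J₂ (J₁ (B u v)) := calc
    J₁ (J₂ (B u v)) = B (J₂ v) (J₁ u) := by rw [h₁, symm (J₂ v), h₂, symm u]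
    _ = J₂ (J₁ (B u v)) := by rw [symm, h₂, symm _ v, h₁, symm v]
  rw [mul₁₂, mul₂₁] at h
  have h' : J₁ (J₂ (B u v)) = 0 := by
    rw [mul₁₂]
    linear_combination (norm := module) (1 / 2 : ℝ) • h
  simpa [sq₁, sq₂] using congrArg (fun w ↦ J₂ (J₁ w)) h'

variable [IsTopologicalAddGroup V] [ContinuousSMul ℝ V]

/-- The endomorphism-valued one-form whose addition turns a hypercomplex connection with torsion `T`
into the Obata connection. -/
def obataTensor (J₁ J₂ J₃ : V →L[ℝ] V) (T : V →L[ℝ] V →L[ℝ] V) : V →L[ℝ] V →L[ℝ] V :=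
  (1 / 2 : ℝ) • ((ContinuousLinearMap.precomp V J₁ ∘L T ∘L J₁)
    - (ContinuousLinearMap.postcomp V J₁ ∘L T ∘L J₁)
    - (ContinuousLinearMap.postcomp V J₃ ∘L T ∘L J₃)
    - (ContinuousLinearMap.postcomp V J₂ ∘L ContinuousLinearMap.precomp V J₁ ∘L T ∘L J₃))

lemma obataTensor_apply (J₁ J₂ J₃ : V →L[ℝ] V) (T : V →L[ℝ] V →L[ℝ] V) (v u : V) :
    obataTensor J₁ J₂ J₃ T v u = (1 / 2 : ℝ) • (T (J₁ v) (J₁ u) - J₁ (T (J₁ v) u)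
      - J₃ (T (J₃ v) u) - J₂ (T (J₃ v) (J₁ u))) := by
  simp [obataTensor]

variable {J₁ J₂ J₃ : V →L[ℝ] V} {T : V →L[ℝ] V →L[ℝ] V}

lemma obataTensor_commute₁ (sq₁ : ∀ v, J₁ (J₁ v) = -v)
    (mul₁₂ : ∀ v, J₁ (J₂ v) = J₃ v) (mul₂₁ : ∀ v, J₂ (J₁ v) = -J₃ v)
    (type₁ : ∀ u v, T u v = T (J₁ u) (J₁ v) - J₁ (T (J₁ u) v) - J₁ (T u (J₁ v))) (v u : V) :
    obataTensor J₁ J₂ J₃ T (J₁ v) u = J₁ (obataTensor J₁ J₂ J₃ T v u) := by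
  have mul₁₃ (w : V) : J₁ (J₃ w) = -J₂ w := by rw [← mul₁₂, sq₁]
  have mul₃₁ (w : V) : J₃ (J₁ w) = J₂ w := by rw [← mul₁₂, mul₂₁, map_neg, mul₁₃, neg_neg]
  -- `e₁` settles the terms coming from `P v`, and `e₂` those coming from `J₂ (P (J₂ v))`.
  have e₁ := congrArg J₁ (type₁ v u)
  have e₂ := congrArg J₃ (type₁ (J₂ v) u)
  simp only [map_sub, sq₁] at e₁
  simp only [map_sub, mul₁₂, mul₃₁] at e₂
  simp only [obataTensor_apply, map_smul, map_sub, sq₁, mul₁₂, mul₁₃, mul₃₁, map_neg,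
    _root_.neg_apply]
  linear_combination (norm := module) (1 / 2 : ℝ) • e₁ - (1 / 2 : ℝ) • e₂

/-- Purely formal: both sides contain the same four terms, with the first and fourth exchanged, and
the second and third. -/
lemma obataTensor_commute₂ (sq₂ : ∀ v, J₂ (J₂ v) = -v)
    (mul₁₂ : ∀ v, J₁ (J₂ v) = J₃ v) (mul₂₁ : ∀ v, J₂ (J₁ v) = -J₃ v) (v u : V) :
    obataTensor J₁ J₂ J₃ T (J₂ v) u = J₂ (obataTensor J₁ J₂ J₃ T v u) := by
  have mul₃₂ (w : V) : J₃ (J₂ w) = -J₁ w := by rw [← mul₁₂, sq₂, map_neg]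
  have mul₂₃ (w : V) : J₂ (J₃ w) = J₁ w := by
    rw [← neg_neg (J₃ w), ← mul₂₁, map_neg, sq₂, neg_neg]
  simp only [obataTensor_apply, map_smul, map_sub, sq₂, mul₁₂, mul₂₁, mul₂₃, mul₃₂, map_neg,
    _root_.neg_apply]
  module

lemma obataTensor_sub_swap (mul₂₁ : ∀ v, J₂ (J₁ v) = -J₃ v)
    (anti : ∀ u v, T u v = -T v u)
    (type₁ : ∀ u v, T u v = T (J₁ u) (J₁ v) - J₁ (T (J₁ u) v) - J₁ (T u (J₁ v)))
    (type₂ : ∀ u v, T u v = T (J₂ u) (J₂ v) - J₂ (T (J₂ u) v) - J₂ (T u (J₂ v)))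
    (type₃ : ∀ u v, T u v = T (J₃ u) (J₃ v) - J₃ (T (J₃ u) v) - J₃ (T u (J₃ v))) (u v : V) :
    obataTensor J₁ J₂ J₃ T v u - obataTensor J₁ J₂ J₃ T u v = -T u v := by
  have e₁ := type₁ u v
  -- Evaluating at `J₁u, J₁v` produces the mixed terms `J₂T(J₃·, J₁·)`, since `J₂J₁ = -J₃`.
  have e₂ := type₂ (J₁ u) (J₁ v)
  have e₃ := type₃ u v
  simp only [mul₂₁, map_neg, _root_.neg_apply] at e₂
  simp only [obataTensor_apply]
  rw [anti (J₁ v) (J₁ u), anti (J₁ v) u, anti (J₃ v) u, anti (J₃ v) (J₁ u)]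
  simp only [map_neg]
  linear_combination (norm := module) (1 / 2 : ℝ) • e₁ - (1 / 2 : ℝ) • e₂ + (1 / 2 : ℝ) • e₃

end QuaternionicAlgebra

/-! ### Torsion of connections preserving a complex structure -/

namespace AlmostComplexStructure

variable [IsManifold I 1 M] (J : AlmostComplexStructure I M)

lemma mdifferentiableAt_app {X : ∀ x : M, TangentSpace I x} {x : M} (hX : MDiffAt (T% X) x) :
    MDiffAt (T% (J.app X)) x :=
  ((J.smooth x).mdifferentiableAt (by simp)).clm_bundle_apply hX

lemma contMDiff_app {X : ∀ x : M, TangentSpace I x} (hX : CMDiff ∞ (T% X)) :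
    CMDiff ∞ (T% (J.app X)) :=
  J.smooth.clm_bundle_apply hX

end AlmostComplexStructure

/-- The torsion of a connection preserving an integrable complex structure has no component of type
`(0, 2)`. -/
lemma torsion_eq_of_preserves [FiniteDimensional ℝ E] [IsManifold I 2 M] [IsManifold I 1 M]
    {cov : CovariantDerivative I E (TangentSpace I : M → Type _)} {J : AlmostComplexStructure I M}
    (hJ : Preserves cov J) (hint : J.IsIntegrable) (x : M) (u v : TangentSpace I x) :
    cov.torsion x u v = cov.torsion x (J x u) (J x v) - J x (cov.torsion x (J x u) v)
      - J x (cov.torsion x u (J x v)) := by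
  obtain ⟨X, hX, rfl⟩ : ∃ X : ∀ x : M, TangentSpace I x, MDiffAt (T% X) x ∧ X x = u :=
    ⟨FiberBundle.extend E u, FiberBundle.mdifferentiableAt_extend .., by simp⟩
  obtain ⟨Y, hY, rfl⟩ : ∃ Y : ∀ x : M, TangentSpace I x, MDiffAt (T% Y) x ∧ Y x = v :=
    ⟨FiberBundle.extend E v, FiberBundle.mdifferentiableAt_extend .., by simp⟩
  have hJX := J.mdifferentiableAt_app hX
  have hJY := J.mdifferentiableAt_app hY
  have hN := hint X Y x hX hY
  have e₁ := cov.torsion_apply hX hY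
  have e₂ := cov.torsion_apply hJX hJY
  have e₃ := congrArg (J x) (cov.torsion_apply hJX hY)
  have e₄ := congrArg (J x) (cov.torsion_apply hX hJY)
  rw [hJ _ _ _ hX, hJ _ _ _ hY] at e₂
  rw [hJ _ _ _ hX] at e₃
  rw [hJ _ _ _ hY] at e₄
  simp only [map_sub, J.sq] at e₃ e₄
  simp only [AlmostComplexStructure.nijenhuis] at hN
  simp only [AlmostComplexStructure.app] at e₁ e₂ e₃ e₄ hN
  rw [e₁, e₂, e₃, e₄]
  -- All covariant derivatives cancel; the remaining brackets form the Nijenhuis tensor.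
  linear_combination (norm := module) hN

/-- The torsion of a smooth connection maps smooth vector fields to smooth vector fields. -/
lemma contMDiff_torsion_apply [FiniteDimensional ℝ E] [IsManifold I ∞ M] [IsManifold I 2 M]
    [IsManifold I 1 M]
    {cov : CovariantDerivative I E (TangentSpace I : M → Type _)}
    (hcov : cov.ContMDiffCovariantDerivative ∞) {X Y : ∀ x : M, TangentSpace I x}
    (hX : CMDiff ∞ (T% X)) (hY : CMDiff ∞ (T% Y)) :
    CMDiff ∞ (T% (fun x ↦ cov.torsion x (X x) (Y x))) := by
  have h (x : M) : cov.torsion x (X x) (Y x) =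
      cov Y x (X x) - cov X x (Y x) - mlieBracket I X Y x :=
    cov.torsion_apply ((hX x).mdifferentiableAt (by simp)) ((hY x).mdifferentiableAt (by simp))
  simp_rw [h]
  have hc {Z W : ∀ x : M, TangentSpace I x} (hZ : CMDiff ∞ (T% Z)) (hW : CMDiff ∞ (T% W)) :
      CMDiff ∞ (T% (fun x ↦ cov Z x (W x))) :=
    (contMDiffOn_univ.1 (hcov.contMDiff.contMDiff (contMDiffOn_univ.2 hZ))).clm_bundle_apply hW
  have : IsManifold I (minSmoothness ℝ 2) M := by
    rw [minSmoothness_of_isRCLikeNormedField]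
    infer_instance
  -- The bracket costs one derivative, and `∞ + 1` is `∞`.
  have : IsManifold I ((⊤ : ℕ∞) + 1) M := ‹IsManifold I ∞ M›
  exact ((hc hY hX).sub_section (hc hX hY)).sub_section
    (ContDiff.mlieBracket_vectorField (m := ⊤) (n := ⊤) hX hY (by simp))

/-! ### Existence and uniqueness of the Obata connection -/

section Obata

section Structure

variable [IsManifold I 1 M] (S : HypercomplexStructure I M)

/-- The one-form with values in endomorphisms that turns the connection `cov` into the Obata
connection. -/
def HypercomplexStructure.obataForm [FiniteDimensional ℝ E] [IsManifold I 2 M]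
    (cov : CovariantDerivative I E (TangentSpace I : M → Type _)) (x : M) :
    TangentSpace I x →L[ℝ] TangentSpace I x →L[ℝ] TangentSpace I x :=
  obataTensor (S.J₁ x) (S.J₂ x) (S.J₃ x) (cov.torsion x)

variable {S}

lemma preserves_addOneForm {cov : CovariantDerivative I E (TangentSpace I : M → Type _)}
    {J : AlmostComplexStructure I M} (hJ : Preserves cov J)
    {A : ∀ x : M, TangentSpace I x →L[ℝ] TangentSpace I x →L[ℝ] TangentSpace I x}
    (hA : ∀ (x : M) (v u : TangentSpace I x), A x (J x v) u = J x (A x v u)) :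
    Preserves (cov.addOneForm A) J := by
  intro Y x v hY
  have h := hJ Y x v hY
  have h' := hA x (Y x) v
  change cov (J.app Y) x v + A x (J x (Y x)) v = J x (cov Y x v + A x (Y x) v)
  rw [h, h', map_add]

/-- The product of two preserved almost complex structures is preserved. -/
lemma preserves_of_mul {cov : CovariantDerivative I E (TangentSpace I : M → Type _)}
    {J K L : AlmostComplexStructure I M} (hJ : Preserves cov J) (hK : Preserves cov K)
    (hL : ∀ (x : M) (v : TangentSpace I x), J x (K x v) = L x v) : Preserves cov L := by
  intro Y x v hY
  have h : L.app Y = J.app (K.app Y) := funext fun y ↦ (hL y (Y y)).symm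
  rw [h, hJ _ x v (K.mdifferentiableAt_app hY), hK _ x v hY, hL]

end Structure

/-- The Obata connection exists as soon as there is a hypercomplex connection. -/
theorem isObataConnection_addOneForm [FiniteDimensional ℝ E] [T2Space M]
    [IsManifold I ∞ M] [IsManifold I 2 M] [IsManifold I 1 M] {S : HypercomplexStructure I M}
    {cov : CovariantDerivative I E (TangentSpace I : M → Type _)}
    (h : IsHypercomplexConnection S cov) :
    IsObataConnection S (cov.addOneForm (S.obataForm cov)) := by
  have type₁ := torsion_eq_of_preserves h.preserves₁ S.integrable₁
  have type₂ := torsion_eq_of_preserves h.preserves₂ S.integrable₂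
  have type₃ := torsion_eq_of_preserves h.preserves₃ S.integrable₃
  have p₁ : Preserves (cov.addOneForm (S.obataForm cov)) S.J₁ :=
    preserves_addOneForm h.preserves₁ fun x v u ↦
      obataTensor_commute₁ (S.J₁.sq x) (S.mul₁₂ x) (S.mul₂₁ x) (type₁ x) v u
  have p₂ : Preserves (cov.addOneForm (S.obataForm cov)) S.J₂ :=
    preserves_addOneForm h.preserves₂ fun x v u ↦
      obataTensor_commute₂ (S.J₂.sq x) (S.mul₁₂ x) (S.mul₂₁ x) v u
  refine ⟨⟨⟨⟨fun {σ} hσ ↦ ?_⟩⟩, p₁, p₂, preserves_of_mul p₁ p₂ S.mul₁₂⟩, ?_⟩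
  · rw [contMDiffOn_univ] at hσ ⊢
    refine ContMDiff.add_section (contMDiffOn_univ.1
      (h.smooth.contMDiff.contMDiff (contMDiffOn_univ.2 hσ))) ?_
    refine contMDiff_hom_section_of_forall_apply fun X hX ↦ ?_
    have hT {X Y : ∀ x : M, TangentSpace I x} := contMDiff_torsion_apply h.smooth (X := X) (Y := Y)
    have hσ₁ := S.J₁.contMDiff_app hσ
    have hσ₃ := S.J₃.contMDiff_app hσ
    have hX₁ := S.J₁.contMDiff_app hX
    have := ((((hT hσ₁ hX₁).sub_section (S.J₁.contMDiff_app (hT hσ₁ hX))).sub_section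
      (S.J₃.contMDiff_app (hT hσ₃ hX))).sub_section
      (S.J₂.contMDiff_app (hT hσ₃ hX₁))).const_smul_section (a := (1 / 2 : ℝ))
    simp_rw [HypercomplexStructure.obataForm, obataTensor_apply]
    exact this
  · rw [CovariantDerivative.torsion_eq_zero_iff]
    intro X Y x hX hY
    have e := cov.torsion_apply hX hY
    have e' := obataTensor_sub_swap (S.mul₂₁ x) cov.torsion_antisymm (type₁ x) (type₂ x)
      (type₃ x) (X x) (Y x)
    rw [e] at e'
    change cov Y x (X x) + obataTensor _ _ _ _ (Y x) (X x)
      - (cov X x (Y x) + obataTensor _ _ _ _ (X x) (Y x)) = _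
    linear_combination (norm := module) e'

/-- Obata connections are unique. -/
theorem IsObataConnection.eq_of_mdifferentiableAt [FiniteDimensional ℝ E] [IsManifold I 2 M]
    [IsManifold I 1 M]
    {S : HypercomplexStructure I M}
    {cov cov' : CovariantDerivative I E (TangentSpace I : M → Type _)}
    (h : IsObataConnection S cov) (h' : IsObataConnection S cov')
    {Y : ∀ x : M, TangentSpace I x} {x : M} (hY : MDiffAt (T% Y) x) (v : TangentSpace I x) :
    cov Y x v = cov' Y x v := by
  have ext_field (w : TangentSpace I x) :
      ∃ X : ∀ x : M, TangentSpace I x, MDiffAt (T% X) x ∧ X x = w :=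
    ⟨FiberBundle.extend E w, FiberBundle.mdifferentiableAt_extend .., by simp⟩
  have hB {X : ∀ x : M, TangentSpace I x} (hX : MDiffAt (T% X) x) :
      cov.difference cov' x (X x) = cov X x - cov' X x :=
    IsCovariantDerivativeOn.difference_apply _ _ (by trivial) hX
  have hcomm {J : AlmostComplexStructure I M} (hJ : Preserves cov J) (hJ' : Preserves cov' J)
      (u w : TangentSpace I x) :
      cov.difference cov' x (J x w) u = J x (cov.difference cov' x w u) := by
    obtain ⟨X, hX, rfl⟩ := ext_field w
    have := hB (J.mdifferentiableAt_app hX)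
    simp only [AlmostComplexStructure.app] at this
    rw [this, hB hX, sub_apply, sub_apply, map_sub, ← hJ X x u hX, ← hJ' X x u hX]
  have hsymm (u w : TangentSpace I x) :
      cov.difference cov' x w u = cov.difference cov' x u w := by
    obtain ⟨X, hX, rfl⟩ := ext_field u
    obtain ⟨Z, hZ, rfl⟩ := ext_field w
    have e := (CovariantDerivative.torsion_eq_zero_iff cov).1 h.torsion_eq_zero hX hZ
    have e' := (CovariantDerivative.torsion_eq_zero_iff cov').1 h'.torsion_eq_zero hX hZ
    rw [hB hX, hB hZ, sub_apply, sub_apply]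
    linear_combination (norm := module) e - e'
  -- The arguments are swapped so that the differentiated slot, the one linear over the `Jₛ`, comes
  -- second.
  have := eq_zero_of_symm_of_commute (B := fun u w ↦ cov.difference cov' x w u) hsymm
    (S.J₁.sq x) (S.J₂.sq x) (S.mul₁₂ x) (S.mul₂₁ x) (hcomm h.preserves₁ h'.preserves₁)
    (hcomm h.preserves₂ h'.preserves₂) v (Y x)
  simp only [hB hY] at this
  exact sub_eq_zero.1 this

/-! ### Comparison with the tensor `A` -/

section Metric

variable [IsManifold I 1 M] {g : ContMDiffRiemannianMetric I ∞ E (TangentSpace I : M → Type _)}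

lemma IsHermitian.inner_apply_left {J : AlmostComplexStructure I M} (h : IsHermitian g J) (x : M)
    (u v : TangentSpace I x) : g.inner x (J x u) v = -g.inner x u (J x v) := by
  rw [← h x (J x u) v, J.sq]
  simp

/-- Antisymmetry of the torsion puts the direction `u` first, and skewness of each `Jₛ` moves the
outer `Jₛ` onto `w`. -/
lemma inner_obataForm [FiniteDimensional ℝ E] [IsManifold I 2 M] {S : HypercomplexStructure I M}
    (hg : IsHyperhermitian g S) (cov : CovariantDerivative I E (TangentSpace I : M → Type _))
    (x : M) (u v w : TangentSpace I x) :
    g.inner x (S.obataForm cov x v u) w = differenceTensor g S cov x u v w := by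
  rw [HypercomplexStructure.obataForm, obataTensor_apply,
    cov.torsion_antisymm (S.J₁ x v) (S.J₁ x u), cov.torsion_antisymm (S.J₁ x v) u,
    cov.torsion_antisymm (S.J₃ x v) u,
    cov.torsion_antisymm (S.J₃ x v) (S.J₁ x u)]
  simp only [map_smul, map_sub, map_neg, smul_apply, sub_apply, _root_.neg_apply,
    hg.hermitian₁.inner_apply_left, hg.hermitian₂.inner_apply_left, hg.hermitian₃.inner_apply_left,
    differenceTensor, torsion₃, smul_eq_mul]
  ring

end Metric

end Obata

end

theorem mainTheorem6 (n : ℕ) {M : Type*} [TopologicalSpace M] [T2Space M]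
    [SecondCountableTopology M]
    [ChartedSpace (EuclideanSpace ℝ (Fin (4 * n))) M] [IsManifold (𝓡 (4 * n)) ∞ M]
    (g : ContMDiffRiemannianMetric (𝓡 (4 * n)) ∞ (EuclideanSpace ℝ (Fin (4 * n)))
      (TangentSpace (𝓡 (4 * n)) : M → Type _))
    (S : HypercomplexStructure (𝓡 (4 * n)) M) (hgS : IsHyperhermitian g S)
    (nabla : CovariantDerivative (𝓡 (4 * n)) (EuclideanSpace ℝ (Fin (4 * n)))
      (TangentSpace (𝓡 (4 * n)) : M → Type _))
    (hnabla : IsHKTConnection g S nabla) :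
    (∃ nablaOb : CovariantDerivative (𝓡 (4 * n)) (EuclideanSpace ℝ (Fin (4 * n)))
      (TangentSpace (𝓡 (4 * n)) : M → Type _), IsObataConnection S nablaOb) ∧
    ∀ nablaOb : CovariantDerivative (𝓡 (4 * n)) (EuclideanSpace ℝ (Fin (4 * n)))
      (TangentSpace (𝓡 (4 * n)) : M → Type _), IsObataConnection S nablaOb →
      ∀ (X Y Z : ∀ x : M, TangentSpace (𝓡 (4 * n)) x) (x : M),
        MDifferentiableAt (𝓡 (4 * n)) (𝓡 (4 * n)).tangent
          (fun y : M ↦ (⟨y, Y y⟩ : TangentBundle (𝓡 (4 * n)) M)) x →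
        g.inner x (nablaOb Y x (X x)) (Z x) =
          g.inner x (nabla Y x (X x)) (Z x)
            + differenceTensor g S nabla x (X x) (Y x) (Z x) := by
  have hob := isObataConnection_addOneForm hnabla.toIsHypercomplexConnection
  refine ⟨⟨_, hob⟩, fun nablaOb h X Y Z x hY ↦ ?_⟩
  rw [h.eq_of_mdifferentiableAt hob hY (X x), ← inner_obataForm hgS]
  change g.inner x (nabla Y x (X x) + S.obataForm nabla x (Y x) (X x)) (Z x) = _
  rw [map_add, add_apply]
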